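/- Let $m\ge 5$ be odd, $N=3^m-1$ and $n=N/2=\frac{3^m-1}{2}$, and let $\beta$ be a primitive element of $\mathrm{GF}(3^m)$. For an integer $i$ with $0\le i\le N-1$ and $3$-adic expansion $i=\sum_{t=0}^{m-1} i_t3^t$, $i_t\in\{0,1,2\}$, put $\mathrm{wt}_3(i)=\sum_{t=0}^{m-1} i_t$, and let $\mathbb{M}_{\beta^i}(x)$ be the minimal polynomial of $\beta^i$ over $\mathrm{GF}(3)$. The $3$-cyclotomic coset of $i$ modulo $N$ is $\{i3^k \bmod N : k\ge 0\}\subseteq\{0,\dots,N-1\}$, and its smallest element is its coset leader; let $\Gamma^{(1)}$ be the set of odd coset leaders. For $j\in\{1,3\}$ let $$g_{(j,m)}(x)=\prod_{i\in\Gamma^{(1)},\ \mathrm{wt}_3(i)\equiv j \ (\mathrm{mod}\ 4)}\mathbb{M}_{\beta^i}(x)\in \mathrm{GF}(3)[x],$$ and let $\mathcal{C}_{(j,m)}\subseteq \mathrm{GF}(3)^n$ be the ternary negacyclic code of length $n$ generated by $g_{(j,m)}$, that is, the set of all $(c_0,\dots,c_{n-1})\in\mathrm{GF}(3)^n$ for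 which the class of $c_0+c_1x+\cdots+c_{n-1}x^{n-1}$ lies in the ideal generated by $g_{(j,m)}$ in $\mathrm{GF}(3)[x]/(x^n+1)$. Then $\mathcal{C}_{(1,m)}$ has dimension and minimum Hamming distance $$\dim \mathcal{C}_{(1,m)}=\frac{3^m-1+2(-1)^{\frac{m+1}{2}}}{4},\qquad d(\mathcal{C}_{(1,m)})\ge \frac{3^{\frac{m-1}{2}}+2+(-1)^{\frac{m-1}{2}}}{4}+3,$$ its dual code (with respect to the standard inner product on $\mathrm{GF}(3)^n$) is $\mathcal{C}_{(1,m)}^{\bot}=\mathcal{C}_{(3,m)}$, and $$\dim \mathcal{C}_{(1,m)}^{\bot}=\frac{3^m-1+2(-1)^{\frac{m-1}{2}}}{4},\qquad d(\mathcal{C}_{(1,m)}^{\bot})\ge \frac{3^{\frac{m-1}{2}}-(-1)^{\frac{m-1}{2}}}{4}+2 .$$ -/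

import Mathlib

open Polynomial

noncomputable section

namespace TernaryNegacyclic

/-! ### Linear codes: minimum distance and dual -/

/-- The minimum Hamming distance of a linear code `C ⊆ F^n`, i.e. the smallest Hamming distance
between two distinct codewords (and `0` when `C` has only one codeword). -/
def minDist {F : Type*} [Field F] [DecidableEq F] {n : ℕ} (C : Submodule F (Fin n → F)) : ℕ :=
  sInf {d : ℕ | ∃ x ∈ C, ∃ y ∈ C, x ≠ y ∧ hammingDist x y = d}

/-- The dual code `C^⊥ = {c : ∑ cᵢ bᵢ = 0 for all b ∈ C}`. -/
def dualCode {F : Type*} [Field F] {n : ℕ} (C : Submodule F (Fin n → F)) :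
    Submodule F (Fin n → F) where
  carrier := {c | ∀ b ∈ C, ∑ i, c i * b i = 0}
  zero_mem' := by
    intro b _
    simp
  add_mem' := by
    intro x y hx hy b hb
    have h1 : ∑ i, x i * b i = 0 := hx b hb
    have h2 : ∑ i, y i * b i = 0 := hy b hb
    simp [add_mul, Finset.sum_add_distrib, h1, h2]
  smul_mem' := by
    intro a x hx b hb
    have h1 : ∑ i, x i * b i = 0 := hx b hb
    simp [mul_assoc, ← Finset.mul_sum, h1]

/-! ### Negacyclic codes -/

/-- The map `Φ : F^n → F[x]/(x^n + 1)`,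
`(c₀, …, c_{n-1}) ↦ c₀ + c₁ x + ⋯ + c_{n-1} x^{n-1}`. -/
def codePoly (F : Type*) [Field F] (n : ℕ) :
    (Fin n → F) →ₗ[F] F[X] ⧸ Ideal.span {(X ^ n + 1 : F[X])} :=
  (Ideal.Quotient.mkₐ F (Ideal.span {(X ^ n + 1 : F[X])})).toLinearMap ∘ₗ
    ∑ i : Fin n, (monomial (i : ℕ)) ∘ₗ LinearMap.proj i

/-- The negacyclic code of length `n` over `F` generated by `g`: the set of all `c ∈ F^n` such that
`Φ c` lies in the principal ideal `(g)` of `F[x]/(x^n + 1)`. -/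
def negacyclicCode {F : Type*} [Field F] (n : ℕ) (g : F[X]) : Submodule F (Fin n → F) :=
  Submodule.comap (codePoly F n)
    ((Ideal.span {Ideal.Quotient.mk (Ideal.span {(X ^ n + 1 : F[X])}) g}).restrictScalars F)

/-! ### Cyclotomic cosets and the codes `C_(j,m)` -/

/-- The `q`-cyclotomic coset of `i` modulo `N`, as a set of residues in `{0, …, N-1}`. -/
def cyclotomicCoset (q N i : ℕ) : Set ℕ :=
  {j | ∃ k : ℕ, j = (i * q ^ k) % N}

open Classical in
/-- The set of odd `q`-cyclotomic coset leaders modulo `N`: the odd elements of `{0, …, N-1}`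
that are the smallest element of their coset. -/
def oddCosetLeaders (q N : ℕ) : Finset ℕ :=
  (Finset.range N).filter fun i => Odd i ∧ ∀ j ∈ cyclotomicCoset q N i, i ≤ j

/-- The `3`-weight of `i`: the sum of the digits of its `3`-adic expansion. -/
def wt3 (i : ℕ) : ℕ := (Nat.digits 3 i).sum

/-- The polynomial `g_(j,m)` over `GF(3)`: the product of the minimal polynomials of `β^i`, over
the odd `3`-cyclotomic coset leaders `i` modulo `3^m - 1` with `wt3 i ≡ j (mod 4)`. -/
def gPoly {K : Type*} [Field K] [Algebra (ZMod 3) K] (m : ℕ) (β : K) (j : ℕ) : (ZMod 3)[X] :=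
  ∏ i ∈ (oddCosetLeaders 3 (3 ^ m - 1)).filter (fun i => wt3 i ≡ j [MOD 4]),
    minpoly (ZMod 3) (β ^ i)

/-- The ternary negacyclic code `C_(j,m)` of length `(3^m - 1)/2` with generator polynomial
`g_(j,m)`. -/
def fourthCode {K : Type*} [Field K] [Algebra (ZMod 3) K] (m : ℕ) (β : K) (j : ℕ) :
    Submodule (ZMod 3) (Fin ((3 ^ m - 1) / 2) → ZMod 3) :=
  negacyclicCode ((3 ^ m - 1) / 2) (gPoly m β j)

end TernaryNegacyclic

end

namespace TernaryNegacyclic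

/-! ### The ternary weight -/

/-! Multiplication by 3 modulo `3 ^ m - 1` rotates ternary digits, so weight classes are unions of
cyclotomic cosets and `gPoly m β j` has exactly the roots `β ^ i` with `wt3 i ≡ j` mod 4. Weight and
integer have the same parity, so classes 1 and 3 partition the odd exponents, i.e. the roots of `X ^
n + 1`.

Dimensions reduce to the sizes of the two classes: their sum is `n`, and their difference follows
from summing a 2-antiperiodic function of the weight (`sum_wt3_of_antiperiodic`).

Negating an exponent sends weight `w` to `2 * m - w`, which fixes both classes since `2 * m ≡ 2` mod
4. Hence at every odd power of `β` either one word of a pair vanishes or the other vanishes at the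
inverse; Fourier inversion gives orthogonality, and dimensions give equality.

For distances put `m = 2 * h + 1`. The exponent `3 ^ (2 * h) + i * (3 ^ h + 1)` has digit 1 followed
by the digits of `i` twice, so its weight `1 + 2 * wt3 i` mod 4 depends only on the parity of `i`.
Even `i` give BCH zeros for class 1, odd `i` for class 3; the resulting bounds are about `3 ^ h /
2`, at least those claimed. -/

lemma wt3_zero : wt3 0 = 0 := by simp [wt3]

lemma wt3_three_mul_add (q r : ℕ) (hr : r < 3) : wt3 (3 * q + r) = wt3 q + r := by
  unfold wt3
  by_cases h : 3 * q + r = 0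
  · obtain ⟨rfl, rfl⟩ : q = 0 ∧ r = 0 := by omega
    simp
  · rw [Nat.digits_def' (by norm_num) (by omega)]
    have h1 : (3 * q + r) % 3 = r := by omega
    have h2 : (3 * q + r) / 3 = q := by omega
    rw [h1, h2, List.sum_cons, add_comm]

lemma wt3_of_lt (r : ℕ) (hr : r < 3) : wt3 r = r := by
  simpa [wt3_zero] using wt3_three_mul_add 0 r hr

lemma wt3_mul_pow_add (a : ℕ) (h : ℕ) : ∀ b, b < 3 ^ h → wt3 (a * 3 ^ h + b) = wt3 a + wt3 b := by
  induction h with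
  | zero =>
    intro b hb
    obtain rfl : b = 0 := by simpa using hb
    simp [wt3_zero]
  | succ h ih =>
    intro b hb
    rw [pow_succ] at hb
    have hb1 : b = 3 * (b / 3) + b % 3 := by omega
    have hr : b % 3 < 3 := Nat.mod_lt _ (by norm_num)
    have e : a * 3 ^ (h + 1) + b = 3 * (a * 3 ^ h + b / 3) + b % 3 := by
      rw [pow_succ]
      have : a * (3 ^ h * 3) = 3 * (a * 3 ^ h) := by ring
      omega
    have e2 : wt3 b = wt3 (b / 3) + b % 3 := by
      conv_lhs => rw [hb1]
      exact wt3_three_mul_add _ _ hr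
    rw [e, wt3_three_mul_add _ _ hr, ih _ (by omega), e2, add_assoc]

lemma wt3_complement (m : ℕ) : ∀ i, i ≤ 3 ^ m - 1 → wt3 (3 ^ m - 1 - i) + wt3 i = 2 * m := by
  induction m with
  | zero =>
    intro i hi
    obtain rfl : i = 0 := by simpa using hi
    simp [wt3_zero]
  | succ m ih =>
    intro i hi
    have hp : 0 < 3 ^ m := by positivity
    rw [pow_succ] at hi ⊢
    have e1 : 3 ^ m * 3 - 1 - i = 3 * (3 ^ m - 1 - i / 3) + (2 - i % 3) := by omega
    have e2 : wt3 i = wt3 (i / 3) + i % 3 := by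
      conv_lhs => rw [← Nat.div_add_mod i 3]
      exact wt3_three_mul_add _ _ (Nat.mod_lt _ (by norm_num))
    rw [e1, wt3_three_mul_add _ _ (by omega), e2]
    have := ih (i / 3) (by omega)
    omega

lemma wt3_modEq_two (i : ℕ) : i % 2 = wt3 i % 2 :=
  Nat.modEq_digits_sum 2 3 (by norm_num) i

lemma wt3_three_mul_mod (m i : ℕ) (hi : i < 3 ^ m - 1) :
    wt3 (i * 3 % (3 ^ m - 1)) = wt3 i := by
  obtain _ | k := m
  · simp at hi
  have hp : 0 < 3 ^ k := by positivity
  rw [pow_succ] at hi ⊢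
  set d := i / 3 ^ k with hd
  set r := i % 3 ^ k with hr
  have hi' : i = d * 3 ^ k + r := by rw [hd, hr, mul_comm]; exact (Nat.div_add_mod i _).symm
  have hrlt : r < 3 ^ k := Nat.mod_lt _ hp
  have hd3 : d < 3 := by
    rw [hd, Nat.div_lt_iff_lt_mul hp]; omega
  have e : i * 3 = 3 * r + d + (3 ^ k * 3 - 1) * d := by
    rw [hi']
    zify [show 1 ≤ 3 ^ k * 3 by omega]
    ring
  have hlt : 3 * r + d < 3 ^ k * 3 - 1 := by
    -- Equality would force every digit of `i` to be 2, i.e. `i = 3 ^ m - 1`, which is excluded.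
    by_contra hcon
    have h1 : d = 2 := by omega
    have h2 : r = 3 ^ k - 1 := by omega
    rw [h1, h2] at hi'
    omega
  rw [e, Nat.add_mul_mod_self_left, Nat.mod_eq_of_lt hlt, wt3_three_mul_add _ _ hd3, hi',
    wt3_mul_pow_add _ _ _ hrlt, wt3_of_lt d hd3, add_comm]

lemma wt3_mul_pow_mod (m i k : ℕ) (hi : i < 3 ^ m - 1) :
    wt3 (i * 3 ^ k % (3 ^ m - 1)) = wt3 i := by
  induction k with
  | zero => simp [Nat.mod_eq_of_lt hi]
  | succ k ih =>
    have hN : 0 < 3 ^ m - 1 := by omega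
    rw [pow_succ, ← mul_assoc, ← Nat.mod_mul_mod, wt3_three_mul_mod m _ (Nat.mod_lt _ hN), ih]

/-- Integers below `3 ^ m - 1` whose ternary weight is `j` modulo `4`. -/
def weightClass (m j : ℕ) : Finset ℕ :=
  (Finset.range (3 ^ m - 1)).filter fun i => wt3 i ≡ j [MOD 4]

lemma mem_weightClass {m j i : ℕ} :
    i ∈ weightClass m j ↔ i < 3 ^ m - 1 ∧ wt3 i ≡ j [MOD 4] := by
  simp [weightClass]

lemma odd_of_wt3_modEq {i j : ℕ} (hj : Odd j) (h : wt3 i ≡ j [MOD 4]) : Odd i := by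
  have h1 := wt3_modEq_two i
  have h2 : wt3 i % 4 = j % 4 := h
  rw [Nat.odd_iff] at hj ⊢
  omega

lemma sum_range_three_mul (F : ℕ → ℤ) (n : ℕ) :
    ∑ i ∈ Finset.range (3 * n), F i
      = ∑ q ∈ Finset.range n, (F (3 * q) + F (3 * q + 1) + F (3 * q + 2)) := by
  induction n with
  | zero => simp
  | succ n ih =>
    rw [Finset.sum_range_succ, ← ih, mul_add, mul_one, Finset.sum_range_succ,
      Finset.sum_range_succ, Finset.sum_range_succ]
    ring

/-- Summing over the last digit gives `f w + f (w + 1) + f (w + 2) = f (w + 1)`, so each digit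
merely shifts `f` by one. -/
lemma sum_wt3_of_antiperiodic (m : ℕ) :
    ∀ f : ℕ → ℤ, (∀ w, f (w + 2) = -f w) → ∑ i ∈ Finset.range (3 ^ m), f (wt3 i) = f m := by
  induction m with
  | zero => intro f _; simp [wt3_zero]
  | succ m ih =>
    intro f hf
    rw [pow_succ, mul_comm, sum_range_three_mul]
    rw [← ih (fun w => f (w + 1)) (fun w => hf (w + 1))]
    refine Finset.sum_congr rfl fun q _ => ?_
    have h0 := wt3_three_mul_add q 0 (by norm_num)
    simp only [add_zero] at h0
    rw [h0, wt3_three_mul_add q 1 (by norm_num), wt3_three_mul_add q 2 (by norm_num), hf]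
    ring

lemma three_pow_mod_four {m : ℕ} (hm : Odd m) : 3 ^ m % 4 = 3 := by
  obtain ⟨h, rfl⟩ := hm
  rw [pow_succ, pow_mul, Nat.mul_mod, Nat.pow_mod]
  norm_num

lemma card_weightClass_sub {m : ℕ} (hm : Odd m) :
    ((weightClass m 1).card : ℤ) - (weightClass m 3).card = (-1) ^ ((m - 1) / 2) := by
  let f : ℕ → ℤ := fun w => (if w % 4 = 1 then 1 else 0) - (if w % 4 = 3 then 1 else 0)
  have hf : ∀ w, f (w + 2) = -f w := by
    intro w
    have : w % 4 < 4 := Nat.mod_lt _ (by norm_num)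
    simp only [f]
    split_ifs <;> omega
  have hfm : ∀ h : ℕ, f (2 * h + 1) = (-1) ^ h := by
    intro h
    induction h with
    | zero => rfl
    | succ h ih => rw [show 2 * (h + 1) + 1 = 2 * h + 1 + 2 by ring, hf, ih, pow_succ]; ring
  have h1 := sum_wt3_of_antiperiodic m f hf
  have hp : 0 < 3 ^ m := by positivity
  rw [← Nat.sub_add_cancel (Nat.one_le_of_lt hp), Finset.sum_range_succ] at h1
  have hlast : f (wt3 (3 ^ m - 1)) = 0 := by
    have h2 := wt3_complement m 0 (Nat.zero_le _)
    simp only [wt3_zero, Nat.sub_zero, add_zero] at h2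
    rw [h2]
    simp only [f]
    split_ifs <;> omega
  rw [hlast, add_zero] at h1
  have h3 : ∑ i ∈ Finset.range (3 ^ m - 1), f (wt3 i)
      = ((weightClass m 1).card : ℤ) - (weightClass m 3).card := by
    simp only [f, Finset.sum_sub_distrib, weightClass, Nat.ModEq, Finset.sum_boole]
    norm_num
  rw [← h3, h1]
  obtain ⟨h, rfl⟩ := hm
  rw [hfm]
  congr 1
  omega

lemma card_weightClass_add {m : ℕ} (hm : Odd m) :
    (weightClass m 1).card + (weightClass m 3).card = (3 ^ m - 1) / 2 := by
  have hd : Disjoint (weightClass m 1) (weightClass m 3) := by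
    rw [Finset.disjoint_left]
    intro i h1 h3
    have h1 := (mem_weightClass.1 h1).2
    have h3 := (mem_weightClass.1 h3).2
    simp only [Nat.ModEq] at h1 h3
    omega
  have hmod := three_pow_mod_four hm
  rw [← Finset.card_union_of_disjoint hd]
  have : weightClass m 1 ∪ weightClass m 3
      = (Finset.range ((3 ^ m - 1) / 2)).image fun s => 2 * s + 1 := by
    ext i
    simp only [Finset.mem_union, mem_weightClass, Finset.mem_image, Finset.mem_range, Nat.ModEq]
    have h2 := wt3_modEq_two i
    constructor
    · intro h
      exact ⟨i / 2, by omega, by omega⟩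
    · rintro ⟨s, hs, rfl⟩
      omega
  rw [this, Finset.card_image_of_injective _ (fun a b h => by simpa using h), Finset.card_range]

/-! ### The BCH bound -/

/-- If a power-sum system with distinct nodes holds for at least as many exponents as there are
nodes, then all coefficients vanish. -/
lemma eq_zero_of_sum_mul_pow_eq_zero {ι K : Type*} [Field K] (S : Finset ι) (v x : ι → K)
    (hx : Set.InjOn x S) (h : ∀ t < S.card, ∑ i ∈ S, v i * x i ^ t = 0) :
    ∀ i ∈ S, v i = 0 := by
  classical
  intro i₀ hi₀
  let p : K[X] := ∏ i ∈ S.erase i₀, (X - C (x i))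
  have hdeg : p.natDegree < S.card := by
    rw [natDegree_prod_of_monic _ _ fun i _ => monic_X_sub_C _]
    simp only [natDegree_X_sub_C, Finset.sum_const, smul_eq_mul, mul_one]
    exact Finset.card_erase_lt_of_mem hi₀
  have hsum : ∑ i ∈ S, v i * p.eval (x i) = 0 := by
    simp_rw [eval_eq_sum_range' hdeg, Finset.mul_sum]
    rw [Finset.sum_comm]
    refine Finset.sum_eq_zero fun t ht => ?_
    rw [← mul_zero (p.coeff t), ← h t (Finset.mem_range.1 ht), Finset.mul_sum]
    exact Finset.sum_congr rfl fun i _ => by ring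
  rw [Finset.sum_eq_single_of_mem i₀ hi₀] at hsum
  · refine (mul_eq_zero.1 hsum).resolve_right ?_
    simp only [p, eval_prod, eval_sub, eval_X, eval_C]
    refine Finset.prod_ne_zero_iff.2 fun i hi => sub_ne_zero.2 fun he => ?_
    exact (Finset.ne_of_mem_erase hi) (hx hi₀ (Finset.mem_of_mem_erase hi) he).symm
  · intro i hi hne
    have : p.eval (x i) = 0 := by
      simp only [p, eval_prod, eval_sub, eval_X, eval_C]
      exact Finset.prod_eq_zero (Finset.mem_erase.2 ⟨hne, hi⟩) (sub_self _)
    rw [this, mul_zero]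

/-- The BCH bound: a nonzero word vanishing at `y, y * x, …, y * x ^ (δ - 1)`, where `x` has order
at least the length of the word, has weight greater than `δ`. -/
lemma lt_hammingNorm_of_zeros {F K : Type*} [Field F] [DecidableEq F] [Field K] [Algebra F K]
    {n : ℕ} (c : Fin n → F) (hc : c ≠ 0) (δ : ℕ) (y x : K) (hy : y ≠ 0)
    (hx : IsPrimitiveRoot x n)
    (h : ∀ t < δ, ∑ k : Fin n, algebraMap F K (c k) * (y * x ^ t) ^ (k : ℕ) = 0) :
    δ < hammingNorm c := by
  by_contra hle
  rw [not_lt] at hle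
  let S : Finset (Fin n) := Finset.univ.filter fun i => c i ≠ 0
  have hS : S.card ≤ δ := hle
  have := eq_zero_of_sum_mul_pow_eq_zero S (fun i => algebraMap F K (c i) * y ^ (i : ℕ))
    (fun i => x ^ (i : ℕ))
    (fun i _ j _ hij => Fin.ext (hx.pow_inj i.2 j.2 hij))
    (fun t ht => by
      rw [← h t (ht.trans_le hS), Finset.sum_filter]
      refine Finset.sum_congr rfl fun k _ => ?_
      split_ifs with hk
      · rw [mul_pow, ← pow_mul, ← pow_mul, mul_comm t, mul_assoc]
      · rw [not_not.1 hk, map_zero, zero_mul])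
  apply hc
  ext i
  by_contra hi
  have h0 := this i (by simpa [S] using hi)
  simp only [mul_eq_zero, map_eq_zero] at h0
  exact h0.elim hi (pow_ne_zero _ hy)

lemma le_minDist {F : Type*} [Field F] [DecidableEq F] {n : ℕ} (C : Submodule F (Fin n → F))
    (hC : C ≠ ⊥) (d : ℕ) (h : ∀ c ∈ C, c ≠ 0 → d ≤ hammingNorm c) : d ≤ minDist C := by
  obtain ⟨c, hc, hc0⟩ := C.exists_mem_ne_zero_of_ne_bot hC
  unfold minDist
  refine le_csInf ⟨_, c, hc, 0, C.zero_mem, hc0, rfl⟩ ?_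
  rintro e ⟨x, hx, y, hy, hxy, rfl⟩
  rw [hammingDist_eq_hammingNorm]
  rw [neg_add_eq_sub]
  exact h _ (C.sub_mem hy hx) (sub_ne_zero.2 hxy.symm)

/-! ### Duals -/

lemma finrank_dualCode {F : Type*} [Field F] {n : ℕ} (C : Submodule F (Fin n → F)) :
    Module.finrank F C + Module.finrank F (dualCode C) = n := by
  let B : LinearMap.BilinForm F (Fin n → F) := Matrix.toBilin' 1
  have hB : ∀ x y, B x y = ∑ i, x i * y i := fun x y => by
    simp [B, Matrix.toBilin'_apply', dotProduct]
  have hker : LinearMap.ker B = ⊥ := by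
    rw [LinearMap.ker_eq_bot']
    intro x hx
    ext i
    have := LinearMap.congr_fun hx (Pi.single i 1)
    simpa [hB, Pi.single_apply] using this
  have e : dualCode C = B.orthogonal C := by
    ext x
    change (∀ b ∈ C, ∑ i, x i * b i = 0) ↔ ∀ b ∈ C, B b x = 0
    simp only [hB, mul_comm]
  have h := LinearMap.BilinForm.finrank_add_finrank_orthogonal' (B := B) C
  rwa [hker, inf_bot_eq, finrank_bot, add_zero, ← e, Module.finrank_fin_fun] at h

/-! ### Generator polynomials -/

/-- The polynomial of a word. -/
noncomputable def wordPoly {F : Type*} [Field F] {n : ℕ} (c : Fin n → F) : F[X] :=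
  ∑ i : Fin n, monomial (i : ℕ) (c i)

lemma mem_negacyclicCode {F : Type*} [Field F] {n : ℕ} {g : F[X]} (hg : g ∣ X ^ n + 1)
    (c : Fin n → F) : c ∈ negacyclicCode n g ↔ g ∣ wordPoly c := by
  have e : codePoly F n c = Ideal.Quotient.mk (Ideal.span {(X ^ n + 1 : F[X])}) (wordPoly c) := by
    simp [codePoly, wordPoly]
  change codePoly F n c ∈ Ideal.span _ ↔ _
  rw [e, Ideal.mem_span_singleton]
  constructor
  · rintro ⟨q, hq⟩
    obtain ⟨q, rfl⟩ := Ideal.Quotient.mk_surjective q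
    rw [← map_mul, Ideal.Quotient.eq, Ideal.mem_span_singleton] at hq
    exact (dvd_sub_left (dvd_mul_right g q)).1 (hg.trans hq)
  · exact fun h => map_dvd _ h

lemma aeval_wordPoly {F K : Type*} [Field F] [Field K] [Algebra F K] {n : ℕ} (c : Fin n → F)
    (z : K) : aeval z (wordPoly c) = ∑ k : Fin n, algebraMap F K (c k) * z ^ (k : ℕ) := by
  simp [wordPoly, aeval_monomial]

/-- The code is the kernel of a map into `AdjoinRoot g`, of dimension `g.natDegree`. This inequality
suffices: duality later supplies the reverse one. -/
lemma le_finrank_negacyclicCode {F : Type*} [Field F] {n : ℕ} {g : F[X]} (hg : g ∣ X ^ n + 1)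
    (h0 : g ≠ 0) : n ≤ Module.finrank F (negacyclicCode n g) + g.natDegree := by
  let W : (Fin n → F) →ₗ[F] F[X] := ∑ i : Fin n, (monomial (i : ℕ)) ∘ₗ LinearMap.proj i
  have hW : ∀ c, W c = wordPoly c := fun c => by simp [W, wordPoly]
  let T : (Fin n → F) →ₗ[F] AdjoinRoot g := (AdjoinRoot.mkₐ g).toLinearMap ∘ₗ W
  have hk : LinearMap.ker T = negacyclicCode n g := by
    ext c
    rw [mem_negacyclicCode hg, LinearMap.mem_ker, ← AdjoinRoot.mk_eq_zero, ← hW]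
    rfl
  have hfin : Module.finrank F (AdjoinRoot g) = g.natDegree := by
    rw [(AdjoinRoot.powerBasis h0).finrank, AdjoinRoot.powerBasis_dim]
  have : Module.Finite F (AdjoinRoot g) := (AdjoinRoot.powerBasis h0).finite
  have h1 := LinearMap.finrank_range_add_finrank_ker T
  rw [hk, Module.finrank_fin_fun] at h1
  have h2 := Submodule.finrank_le (LinearMap.range T)
  omega

/-! ### Zeros of the generator polynomials -/

section Zeros

variable {K : Type*} [Field K] {m : ℕ} {β : K}

lemma pow_mod_order (hβ : IsPrimitiveRoot β (3 ^ m - 1)) (i : ℕ) :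
    β ^ (i % (3 ^ m - 1)) = β ^ i :=
  (pow_eq_pow_mod i hβ.pow_eq_one).symm

lemma three_pow_sub_one_eq (hm : Odd m) : 3 ^ m - 1 = 2 * ((3 ^ m - 1) / 2) := by
  have h4 := three_pow_mod_four hm
  generalize 3 ^ m = q at *
  omega

lemma half_order_pos (hm : Odd m) : 0 < (3 ^ m - 1) / 2 := by
  have h4 := three_pow_mod_four hm
  generalize 3 ^ m = q at *
  omega

lemma isPrimitiveRoot_sq (hm : Odd m) (hβ : IsPrimitiveRoot β (3 ^ m - 1)) :
    IsPrimitiveRoot (β ^ 2) ((3 ^ m - 1) / 2) :=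
  hβ.pow (by have := half_order_pos hm; omega) (three_pow_sub_one_eq hm)

lemma pow_half_order (hm : Odd m) (hβ : IsPrimitiveRoot β (3 ^ m - 1)) :
    β ^ ((3 ^ m - 1) / 2) = -1 := by
  have hn := half_order_pos hm
  have h2 := three_pow_sub_one_eq hm
  have hsq : (β ^ ((3 ^ m - 1) / 2)) ^ 2 = 1 := by
    rw [← pow_mul, mul_comm, ← h2, hβ.pow_eq_one]
  exact (sq_eq_one_iff.1 hsq).resolve_left
    (hβ.pow_ne_one_of_pos_of_lt hn.ne' (by omega))

lemma sum_odd_powers (hm : Odd m) (hβ : IsPrimitiveRoot β (3 ^ m - 1))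
    (k l : Fin ((3 ^ m - 1) / 2)) :
    ∑ s ∈ Finset.range ((3 ^ m - 1) / 2),
        (β ^ (2 * s + 1)) ^ (k : ℕ) * (β ^ (2 * s + 1))⁻¹ ^ (l : ℕ)
      = if k = l then (((3 ^ m - 1) / 2 : ℕ) : K) else 0 := by
  have hn := half_order_pos hm
  have hβ0 : β ≠ 0 := hβ.ne_zero (by omega)
  set z : K := β ^ (k : ℕ) * β⁻¹ ^ (l : ℕ) with hz
  have e : ∀ s, (β ^ (2 * s + 1)) ^ (k : ℕ) * (β ^ (2 * s + 1))⁻¹ ^ (l : ℕ) = z * (z ^ 2) ^ s := by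
    intro s
    rw [← pow_mul z, ← pow_succ', ← inv_pow, hz, mul_pow, ← pow_mul, ← pow_mul, ← pow_mul,
      ← pow_mul, mul_comm (k : ℕ), mul_comm (l : ℕ)]
  simp_rw [e]
  rw [← Finset.mul_sum]
  split_ifs with hkl
  · have : z = 1 := by rw [hz, hkl, ← mul_pow, mul_inv_cancel₀ hβ0, one_pow]
    simp [this]
  · have hz2 : z ^ 2 ≠ 1 := by
      intro h1
      apply hkl
      refine Fin.ext ((isPrimitiveRoot_sq hm hβ).pow_inj k.2 l.2 ?_)
      rw [hz, mul_pow, inv_pow, inv_pow, ← div_eq_mul_inv,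
        div_eq_one_iff_eq (pow_ne_zero _ (pow_ne_zero _ hβ0))] at h1
      rw [← pow_mul, ← pow_mul, mul_comm, mul_comm 2, pow_mul, pow_mul, h1]
    have hpow : (z ^ 2) ^ ((3 ^ m - 1) / 2) = 1 := by
      rw [← pow_mul, ← three_pow_sub_one_eq hm, hz, mul_pow, ← pow_mul, ← pow_mul,
        mul_comm (k : ℕ), mul_comm (l : ℕ), pow_mul, pow_mul, inv_pow β, hβ.pow_eq_one]
      simp
    have hg := geom_sum_mul (z ^ 2) ((3 ^ m - 1) / 2)
    rw [hpow, sub_self] at hg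
    rw [(mul_eq_zero.1 hg).resolve_right (sub_ne_zero.2 hz2), mul_zero]

variable [Algebra (ZMod 3) K]

lemma exists_algEquiv_pow [Finite K] (k : ℕ) : ∃ σ : K ≃ₐ[ZMod 3] K, ∀ z, σ z = z ^ 3 ^ k := by
  refine ⟨FiniteField.frobeniusAlgEquivOfAlgebraic (ZMod 3) K ^ k, fun z => ?_⟩
  rw [AlgEquiv.coe_pow, FiniteField.coe_frobeniusAlgEquivOfAlgebraic_iterate, ZMod.card]

lemma aeval_pow_eq_zero_iff [Finite K] (f : (ZMod 3)[X]) (z : K) (k : ℕ) :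
    aeval (z ^ 3 ^ k) f = 0 ↔ aeval z f = 0 := by
  obtain ⟨σ, hσ⟩ := exists_algEquiv_pow (K := K) k
  rw [← hσ, aeval_algHom_apply σ z f]
  simp

lemma exists_eq_pow_of_minpoly_eq [Finite K] {x y : K}
    (h : minpoly (ZMod 3) x = minpoly (ZMod 3) y) : ∃ k : ℕ, x = y ^ 3 ^ k := by
  obtain ⟨σ, hσ⟩ := IsConjRoot.exists_algEquiv (K := ZMod 3) h
  obtain ⟨k, rfl⟩ := (FiniteField.bijective_frobeniusAlgEquivOfAlgebraic_pow (ZMod 3) K).2 σ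
  refine ⟨k, ?_⟩
  rw [← hσ]
  dsimp only
  rw [AlgEquiv.coe_pow, FiniteField.coe_frobeniusAlgEquivOfAlgebraic_iterate, ZMod.card]

lemma isCoprime_minpoly [Finite K] {x y : K}
    (h : minpoly (ZMod 3) x ≠ minpoly (ZMod 3) y) :
    IsCoprime (minpoly (ZMod 3) x) (minpoly (ZMod 3) y) := by
  have hx : IsIntegral (ZMod 3) x := Algebra.IsIntegral.isIntegral x
  have hy : IsIntegral (ZMod 3) y := Algebra.IsIntegral.isIntegral y
  rw [(minpoly.irreducible hx).coprime_iff_not_dvd]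
  intro hd
  exact h (eq_of_monic_of_associated (minpoly.monic hx) (minpoly.monic hy)
    ((minpoly.irreducible hx).associated_of_dvd (minpoly.irreducible hy) hd))

/-- Equal minimal polynomials make the roots Frobenius conjugate, so the exponents share a coset and
each leader bounds the other. -/
lemma minpoly_ne_of_leaders [Finite K] (hβ : IsPrimitiveRoot β (3 ^ m - 1)) {a b : ℕ}
    (ha : a ∈ oddCosetLeaders 3 (3 ^ m - 1)) (hb : b ∈ oddCosetLeaders 3 (3 ^ m - 1))
    (hab : a ≠ b) : minpoly (ZMod 3) (β ^ a) ≠ minpoly (ZMod 3) (β ^ b) := by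
  have key : ∀ a ∈ oddCosetLeaders 3 (3 ^ m - 1), ∀ b ∈ oddCosetLeaders 3 (3 ^ m - 1),
      minpoly (ZMod 3) (β ^ a) = minpoly (ZMod 3) (β ^ b) → b ≤ a := by
    intro a ha b hb h
    simp only [oddCosetLeaders, Finset.mem_filter, Finset.mem_range] at ha hb
    obtain ⟨k, hk⟩ := exists_eq_pow_of_minpoly_eq h
    refine hb.2.2 a ⟨k, ?_⟩
    refine hβ.pow_inj ha.1 (Nat.mod_lt _ (by omega)) ?_
    rw [pow_mod_order hβ, hk, pow_mul]
  exact fun h => hab (le_antisymm (key b hb a ha h.symm) (key a ha b hb h))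

lemma exists_leader {i : ℕ} (hi : i < 3 ^ m - 1) (ho : Odd i) :
    ∃ k : ℕ, i * 3 ^ k % (3 ^ m - 1) ∈ oddCosetLeaders 3 (3 ^ m - 1) := by
  classical
  have hN : 0 < 3 ^ m - 1 := by omega
  have hne : ∃ l, l ∈ cyclotomicCoset 3 (3 ^ m - 1) i := ⟨_, 0, rfl⟩
  obtain ⟨k, hk⟩ := Nat.find_spec hne
  refine ⟨k, ?_⟩
  simp only [oddCosetLeaders, Finset.mem_filter, Finset.mem_range]
  refine ⟨Nat.mod_lt _ hN, ?_, ?_⟩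
  · rw [Nat.odd_iff] at ho ⊢
    rw [wt3_modEq_two, wt3_mul_pow_mod m i k hi, ← wt3_modEq_two, ho]
  · rintro j ⟨l, rfl⟩
    rw [← hk]
    refine Nat.find_min' hne ⟨k + l, ?_⟩
    rw [hk, Nat.mod_mul_mod, pow_add, mul_assoc]

lemma gPoly_dvd_iff [Finite K] (hβ : IsPrimitiveRoot β (3 ^ m - 1)) {j : ℕ} (hj : Odd j)
    (f : (ZMod 3)[X]) :
    gPoly m β j ∣ f ↔ ∀ i ∈ weightClass m j, aeval (β ^ i) f = 0 := by
  constructor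
  · intro h i hi
    rw [mem_weightClass] at hi
    obtain ⟨k, hk⟩ := exists_leader hi.1 (odd_of_wt3_modEq hj hi.2)
    rw [← aeval_pow_eq_zero_iff f (β ^ i) k, ← pow_mul, ← pow_mod_order hβ]
    rw [← minpoly.dvd_iff]
    refine dvd_trans (Finset.dvd_prod_of_mem (fun i => minpoly (ZMod 3) (β ^ i))
      (Finset.mem_filter.2 ⟨hk, ?_⟩)) h
    rw [wt3_mul_pow_mod m i k hi.1]
    exact hi.2
  · intro h
    refine Finset.prod_dvd_of_coprime ?_ ?_
    · intro a ha b hb hab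
      simp only [Finset.coe_filter, Set.mem_ofPred_eq] at ha hb
      exact isCoprime_minpoly (minpoly_ne_of_leaders hβ ha.1 hb.1 hab)
    · intro i hi
      rw [Finset.mem_filter] at hi
      refine minpoly.dvd _ _ (h i (mem_weightClass.2 ⟨?_, hi.2⟩))
      have hl := hi.1
      simp only [oddCosetLeaders, Finset.mem_filter, Finset.mem_range] at hl
      exact hl.1

lemma gPoly_monic [Finite K] (m : ℕ) (β : K) (j : ℕ) : (gPoly m β j).Monic :=
  monic_prod_of_monic _ _ fun _ _ => minpoly.monic (Algebra.IsIntegral.isIntegral _)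

lemma card_weightClass_le_natDegree [Finite K] (hβ : IsPrimitiveRoot β (3 ^ m - 1)) {j : ℕ}
    (hj : Odd j) : (weightClass m j).card ≤ (gPoly m β j).natDegree := by
  classical
  have hg := gPoly_monic m β j
  have h0 : (gPoly m β j).map (algebraMap (ZMod 3) K) ≠ 0 := (hg.map _).ne_zero
  rw [← hg.natDegree_map (algebraMap (ZMod 3) K),
    ← Finset.card_image_of_injOn (s := weightClass m j) (f := fun i => β ^ i)]
  · refine card_le_degree_of_subset_roots fun z hz => ?_
    obtain ⟨i, hi, rfl⟩ := Finset.mem_image.1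
      (show z ∈ (weightClass m j).image fun i => β ^ i from hz)
    rw [mem_roots h0, IsRoot.def, eval_map_algebraMap]
    exact (gPoly_dvd_iff hβ hj _).1 dvd_rfl i hi
  · intro a ha b hb hab
    exact hβ.pow_inj (mem_weightClass.1 ha).1 (mem_weightClass.1 hb).1 hab

lemma gPoly_dvd [Finite K] (hm : Odd m) (hβ : IsPrimitiveRoot β (3 ^ m - 1)) {j : ℕ}
    (hj : Odd j) : gPoly m β j ∣ X ^ ((3 ^ m - 1) / 2) + 1 := by
  rw [gPoly_dvd_iff hβ hj]
  intro i hi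
  have ho := odd_of_wt3_modEq hj (mem_weightClass.1 hi).2
  rw [map_add, map_one, map_pow, aeval_X, ← pow_mul, mul_comm, pow_mul, pow_half_order hm hβ,
    ho.neg_one_pow, neg_add_cancel]

lemma natDegree_gPoly_add_le [Finite K] (hm : Odd m) (hβ : IsPrimitiveRoot β (3 ^ m - 1)) :
    (gPoly m β 1).natDegree + (gPoly m β 3).natDegree ≤ (3 ^ m - 1) / 2 := by
  have hn := half_order_pos hm
  have hcop : IsCoprime (gPoly m β 1) (gPoly m β 3) := by
    refine IsCoprime.prod_left fun a ha => IsCoprime.prod_right fun b hb => ?_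
    rw [Finset.mem_filter] at ha hb
    refine isCoprime_minpoly (minpoly_ne_of_leaders hβ ha.1 hb.1 ?_)
    rintro rfl
    have h1 := ha.2
    have h3 := hb.2
    simp only [Nat.ModEq] at h1 h3
    omega
  have hd := hcop.mul_dvd (gPoly_dvd hm hβ odd_one) (gPoly_dvd hm hβ (by decide : Odd 3))
  have hdeg : (X ^ ((3 ^ m - 1) / 2) + 1 : (ZMod 3)[X]).natDegree = (3 ^ m - 1) / 2 := by
    rw [← C_1]; exact natDegree_X_pow_add_C
  have hne : (X ^ ((3 ^ m - 1) / 2) + 1 : (ZMod 3)[X]) ≠ 0 := by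
    intro h0
    rw [h0, natDegree_zero] at hdeg
    omega
  rw [← (gPoly_monic m β 1).natDegree_mul (gPoly_monic m β 3)]
  exact (natDegree_le_of_dvd hd hne).trans hdeg.le

/-- Counting roots bounds each degree below and coprimality bounds the sum above by `n`, the total
size of both classes; all are equalities. -/
lemma natDegree_gPoly [Finite K] (hm : Odd m) (hβ : IsPrimitiveRoot β (3 ^ m - 1)) :
    (gPoly m β 1).natDegree = (weightClass m 1).card ∧
      (gPoly m β 3).natDegree = (weightClass m 3).card := by
  have h1 := card_weightClass_le_natDegree hβ odd_one
  have h3 := card_weightClass_le_natDegree hβ (by decide : Odd 3)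
  have h := natDegree_gPoly_add_le hm hβ
  have hc := card_weightClass_add hm
  omega

lemma mem_fourthCode [Finite K] (hm : Odd m) (hβ : IsPrimitiveRoot β (3 ^ m - 1)) {j : ℕ}
    (hj : Odd j) (c : Fin ((3 ^ m - 1) / 2) → ZMod 3) :
    c ∈ fourthCode m β j ↔ ∀ i ∈ weightClass m j,
      ∑ k : Fin ((3 ^ m - 1) / 2), algebraMap (ZMod 3) K (c k) * (β ^ i) ^ (k : ℕ) = 0 := by
  rw [fourthCode, mem_negacyclicCode (gPoly_dvd hm hβ hj), gPoly_dvd_iff hβ hj]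
  simp only [aeval_wordPoly]

/-! ### Duality and dimensions -/

lemma natCast_half_order_ne_zero (hm : Odd m) : (((3 ^ m - 1) / 2 : ℕ) : K) ≠ 0 := by
  intro h
  have : CharP K 3 := (Algebra.charP_iff (ZMod 3) K 3).1 inferInstance
  rw [CharP.cast_eq_zero_iff K 3] at h
  have h2 := three_pow_mod_four hm
  have h3 : 3 ∣ 3 ^ m := dvd_pow_self 3 (by rintro rfl; simp at hm)
  generalize 3 ^ m = q at *
  omega

lemma fourthCode_three_le_dual [Finite K] (hm : Odd m) (hβ : IsPrimitiveRoot β (3 ^ m - 1)) :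
    fourthCode m β 3 ≤ dualCode (fourthCode m β 1) := by
  intro c hc b hb
  rw [mem_fourthCode hm hβ (by decide : Odd 3)] at hc
  rw [mem_fourthCode hm hβ odd_one] at hb
  have hn := half_order_pos hm
  have hβ0 : β ≠ 0 := hβ.ne_zero (by omega)
  have hN := three_pow_sub_one_eq hm
  have hsumpow := sum_odd_powers hm hβ
  have hn0 := natCast_half_order_ne_zero (K := K) hm
  generalize (3 ^ m - 1) / 2 = n at *
  set φ := algebraMap (ZMod 3) K with hφ
  have hzero : ∀ s ∈ Finset.range n,
      (∑ k : Fin n, φ (b k) * (β ^ (2 * s + 1)) ^ (k : ℕ)) *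
        (∑ l : Fin n, φ (c l) * (β ^ (2 * s + 1))⁻¹ ^ (l : ℕ)) = 0 := by
    intro s hs
    rw [Finset.mem_range] at hs
    have hodd := wt3_modEq_two (2 * s + 1)
    by_cases h1 : wt3 (2 * s + 1) % 4 = 1
    · rw [hb (2 * s + 1) (mem_weightClass.2 ⟨by omega, h1⟩), zero_mul]
    -- The weight is odd, hence 3 mod 4, and `2 * m - 3 ≡ 3` mod 4: the inverse is a zero of `c`.
    · have hcomp := wt3_complement m (2 * s + 1) (by omega)
      have hinv : (β ^ (2 * s + 1))⁻¹ = β ^ (3 ^ m - 1 - (2 * s + 1)) := by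
        refine inv_eq_of_mul_eq_one_right ?_
        rw [← pow_add,
          Nat.add_sub_cancel' (by omega), hβ.pow_eq_one]
      rw [hinv, hc (3 ^ m - 1 - (2 * s + 1)) (mem_weightClass.2 ⟨by omega, ?_⟩), mul_zero]
      rw [Nat.odd_iff] at hm
      change _ % 4 = 3 % 4
      omega
  have hsum := Finset.sum_eq_zero hzero
  simp_rw [Finset.sum_mul_sum] at hsum
  rw [Finset.sum_comm] at hsum
  simp_rw [Finset.sum_comm (s := Finset.range n)] at hsum
  have e : ∀ k l : Fin n, ∑ s ∈ Finset.range n,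
      φ (b k) * (β ^ (2 * s + 1)) ^ (k : ℕ) * (φ (c l) * (β ^ (2 * s + 1))⁻¹ ^ (l : ℕ))
      = if k = l then φ (b k) * φ (c l) * (n : K) else 0 := by
    intro k l
    rw [← mul_zero (φ (b k) * φ (c l)), ← mul_ite, ← hsumpow k l, Finset.mul_sum]
    exact Finset.sum_congr rfl fun s _ => by ring
  simp_rw [e, Finset.sum_ite_eq, Finset.mem_univ, if_true, ← Finset.sum_mul] at hsum
  have h0 := (mul_eq_zero.1 hsum).resolve_right hn0
  apply φ.injective
  rw [map_zero, ← h0, map_sum]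
  exact Finset.sum_congr rfl fun i _ => by rw [map_mul, mul_comm]

lemma finrank_fourthCode [Finite K] (hm : Odd m) (hβ : IsPrimitiveRoot β (3 ^ m - 1)) :
    Module.finrank (ZMod 3) (fourthCode m β 1) = (weightClass m 3).card ∧
      Module.finrank (ZMod 3) (fourthCode m β 3) = (weightClass m 1).card ∧
      dualCode (fourthCode m β 1) = fourthCode m β 3 := by
  have h1 := le_finrank_negacyclicCode (gPoly_dvd hm hβ odd_one) (gPoly_monic m β 1).ne_zero
  have h3 := le_finrank_negacyclicCode (gPoly_dvd hm hβ (by decide : Odd 3))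
    (gPoly_monic m β 3).ne_zero
  obtain ⟨d1, d3⟩ := natDegree_gPoly hm hβ
  have hd := finrank_dualCode (fourthCode m β 1)
  have hle := fourthCode_three_le_dual hm hβ
  have hle' := Submodule.finrank_mono hle
  have hc := card_weightClass_add hm
  change _ ≤ Module.finrank (ZMod 3) (fourthCode m β 1) + _ at h1
  change _ ≤ Module.finrank (ZMod 3) (fourthCode m β 3) + _ at h3
  exact ⟨by omega, by omega, (Submodule.eq_of_le_of_finrank_eq hle (by omega)).symm⟩

/-! ### Minimum distances -/

lemma coprime_three_pow_add_one (h : ℕ) :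
    (3 ^ h + 1).Coprime ((3 ^ (2 * h + 1) - 1) / 2) := by
  have hodd : Odd (2 * h + 1) := odd_two_mul_add_one h
  have h4 := three_pow_mod_four hodd
  have h2 := three_pow_sub_one_eq hodd
  set n := (3 ^ (2 * h + 1) - 1) / 2
  set g := (3 ^ h + 1).gcd n with hg
  have h1 : g ∣ 3 ^ h + 1 := Nat.gcd_dvd_left _ _
  have hgn : g ∣ n := Nat.gcd_dvd_right _ _
  have hg2 : g ∣ 2 := by
    zify at h1 hgn ⊢
    -- A common divisor divides 2 by this identity, and `n` is odd.
    have e : (2 : ℤ) = 2 * n - 3 * (3 ^ h - 1) * (3 ^ h + 1) := by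
      have : (2 * n : ℤ) = 3 ^ (2 * h + 1) - 1 := by
        have hp : 1 ≤ 3 ^ (2 * h + 1) := Nat.one_le_pow _ _ (by norm_num)
        rw [← Nat.cast_ofNat, ← Nat.cast_mul, ← h2]
        push_cast [hp]
        rfl
      rw [this, pow_succ, mul_comm 2 h, pow_mul]
      ring
    rw [e]
    exact dvd_sub (hgn.mul_left _) (h1.mul_left _)
  have hnodd : n % 2 = 1 := by
    generalize 3 ^ (2 * h + 1) = q at *
    omega
  rcases (Nat.dvd_prime Nat.prime_two).1 hg2 with h' | h'
  · exact h'
  · rw [h'] at hgn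
    omega

lemma wt3_bch_exponent (h i : ℕ) (hi : i < 3 ^ h) :
    wt3 (3 ^ (2 * h) + i * (3 ^ h + 1)) = 1 + 2 * wt3 i := by
  have e : 3 ^ (2 * h) + i * (3 ^ h + 1) = (1 * 3 ^ h + i) * 3 ^ h + i := by ring
  rw [e, wt3_mul_pow_add _ _ _ hi, wt3_mul_pow_add _ _ _ hi, wt3_of_lt 1 (by norm_num)]
  ring

lemma bch_exponent_lt (h i : ℕ) (hh : 0 < h) (hi : i < 3 ^ h) :
    3 ^ (2 * h) + i * (3 ^ h + 1) < 3 ^ (2 * h + 1) - 1 := by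
  obtain ⟨q, hq⟩ : ∃ q, 3 ^ h = q + 3 := by
    refine ⟨3 ^ h - 3, ?_⟩
    have := Nat.pow_le_pow_right (n := 3) (by norm_num) hh
    omega
  have e : 3 ^ (2 * h) = (q + 3) ^ 2 := by rw [← hq, ← pow_mul, mul_comm]
  have hle : i * (3 ^ h + 1) ≤ (q + 2) * (q + 4) := by
    rw [hq]
    exact Nat.mul_le_mul (by omega) (by omega)
  rw [pow_succ, e]
  have : (q + 2) * (q + 4) + (q + 3) ^ 2 + 1 < (q + 3) ^ 2 * 3 := by nlinarith
  omega

/-- BCH along `i = r + 2 * t`: keeping the parity of `i` keeps the class, and the ratio `β ^ (2 * (3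
^ h + 1))` still has order `n`. -/
lemma lt_hammingNorm_fourthCode [Finite K] {h : ℕ} (hh : 0 < h) {β : K}
    (hβ : IsPrimitiveRoot β (3 ^ (2 * h + 1) - 1)) {j : ℕ} (hj : Odd j) (r δ : ℕ)
    (hδ : ∀ t < δ, r + 2 * t < 3 ^ h) (hr : 1 + 2 * r ≡ j [MOD 4])
    (c : Fin ((3 ^ (2 * h + 1) - 1) / 2) → ZMod 3) (hc : c ∈ fourthCode (2 * h + 1) β j)
    (hc0 : c ≠ 0) : δ < hammingNorm c := by
  have hm : Odd (2 * h + 1) := odd_two_mul_add_one h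
  have hn := half_order_pos hm
  have hβ0 : β ≠ 0 := hβ.ne_zero (by omega)
  rw [mem_fourthCode hm hβ hj] at hc
  refine lt_hammingNorm_of_zeros c hc0 δ (β ^ (3 ^ (2 * h) + r * (3 ^ h + 1)))
    ((β ^ 2) ^ (3 ^ h + 1)) (pow_ne_zero _ hβ0)
    ((isPrimitiveRoot_sq hm hβ).pow_of_coprime _ (coprime_three_pow_add_one h)) fun t ht => ?_
  have hlt := hδ t ht
  rw [← hc (3 ^ (2 * h) + (r + 2 * t) * (3 ^ h + 1)) (mem_weightClass.2
    ⟨bch_exponent_lt h _ hh hlt, ?_⟩)]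
  · refine Finset.sum_congr rfl fun k _ => ?_
    rw [← pow_mul, ← pow_mul, ← pow_add]
    congr 3
    ring
  · rw [wt3_bch_exponent h _ hlt]
    have := wt3_modEq_two (r + 2 * t)
    simp only [Nat.ModEq] at hr ⊢
    omega

end Zeros

end TernaryNegacyclic

theorem mainTheorem6 {K : Type*} [Field K] [Algebra (ZMod 3) K] (m : ℕ) (hm : 5 ≤ m)
    (hodd : Odd m) (hK : Nat.card K = 3 ^ m) (β : K) (hβ : IsPrimitiveRoot β (3 ^ m - 1)) :
    (Module.finrank (ZMod 3) (TernaryNegacyclic.fourthCode m β 1) : ℚ)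
        = (3 ^ m - 1 + 2 * (-1) ^ ((m + 1) / 2)) / 4 ∧
    (TernaryNegacyclic.minDist (TernaryNegacyclic.fourthCode m β 1) : ℚ)
        ≥ (3 ^ ((m - 1) / 2) + 2 + (-1) ^ ((m - 1) / 2)) / 4 + 3 ∧
    TernaryNegacyclic.dualCode (TernaryNegacyclic.fourthCode m β 1)
        = TernaryNegacyclic.fourthCode m β 3 ∧
    (Module.finrank (ZMod 3)
        (TernaryNegacyclic.dualCode (TernaryNegacyclic.fourthCode m β 1)) : ℚ)
        = (3 ^ m - 1 + 2 * (-1) ^ ((m - 1) / 2)) / 4 ∧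
    (TernaryNegacyclic.minDist
        (TernaryNegacyclic.dualCode (TernaryNegacyclic.fourthCode m β 1)) : ℚ)
        ≥ (3 ^ ((m - 1) / 2) - (-1) ^ ((m - 1) / 2)) / 4 + 2 := by
  open TernaryNegacyclic in
  have hfin : Finite K := Nat.finite_of_card_ne_zero (by rw [hK]; positivity)
  obtain ⟨f1, f3, hdual⟩ := finrank_fourthCode hodd hβ
  have hadd := card_weightClass_add hodd
  have hsub := card_weightClass_sub hodd
  have hN := three_pow_sub_one_eq hodd
  rw [hdual, f1, f3]
  obtain ⟨h, rfl⟩ := hodd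
  have hh : 2 ≤ h := by omega
  rw [show (2 * h + 1 - 1) / 2 = h by omega] at hsub ⊢
  rw [show (2 * h + 1 + 1) / 2 = h + 1 by omega]
  have hp : 1 ≤ 3 ^ (2 * h + 1) := Nat.one_le_pow _ _ (by norm_num)
  have hadd2 : 2 * ((weightClass (2 * h + 1) 1).card + (weightClass (2 * h + 1) 3).card) + 1
      = 3 ^ (2 * h + 1) := by
    rw [hadd, ← hN, Nat.sub_add_cancel hp]
  have haddq : 2 * (((weightClass (2 * h + 1) 1).card : ℚ) + (weightClass (2 * h + 1) 3).card) + 1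
      = 3 ^ (2 * h + 1) := by exact_mod_cast hadd2
  have hsubq : ((weightClass (2 * h + 1) 1).card : ℚ) - (weightClass (2 * h + 1) 3).card
      = (-1) ^ h := by exact_mod_cast hsub
  have h9 : 9 ≤ 3 ^ h := Nat.pow_le_pow_right (n := 3) (by norm_num) hh
  have hhodd : 3 ^ h % 2 = 1 := Nat.odd_iff.1 (Odd.pow (by decide))
  have h9q : (9 : ℚ) ≤ 3 ^ h := by exact_mod_cast h9
  have hsign : (-1 : ℤ) ^ h = 1 ∨ (-1 : ℤ) ^ h = -1 := neg_one_pow_eq_or ℤ h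
  have hsignq : (-1 : ℚ) ^ h = 1 ∨ (-1 : ℚ) ^ h = -1 := neg_one_pow_eq_or ℚ h
  have hbig : 9 ≤ 3 ^ (2 * h + 1) := h9.trans (Nat.pow_le_pow_right (by norm_num) (by omega))
  -- The sizes add to at least 4 and differ by 1. Nonzero codes are needed because `minDist` of the
  -- zero code is 0.
  have hpos : 0 < (weightClass (2 * h + 1) 1).card ∧ 0 < (weightClass (2 * h + 1) 3).card := by
    generalize 3 ^ (2 * h + 1) = q at hadd2 hbig
    rcases hsign with hs | hs <;> rw [hs] at hsub <;> omega
  have hne : ∀ j, 0 < Module.finrank (ZMod 3) (fourthCode (2 * h + 1) β j) →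
      fourthCode (2 * h + 1) β j ≠ ⊥ := by
    rintro j hj h0
    rw [h0, finrank_bot] at hj
    exact hj.false
  -- There are `(3 ^ h + 1) / 2` even and `(3 ^ h - 1) / 2` odd values of `i` below `3 ^ h`.
  have m1 : (3 ^ h + 1) / 2 + 1 ≤ minDist (fourthCode (2 * h + 1) β 1) :=
    le_minDist _ (hne 1 (f1 ▸ hpos.2)) _ fun c hc hc0 =>
      lt_hammingNorm_fourthCode (by omega) hβ odd_one 0 _ (fun t ht => by omega) rfl c hc hc0
  have m3 : (3 ^ h - 1) / 2 + 1 ≤ minDist (fourthCode (2 * h + 1) β 3) :=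
    le_minDist _ (hne 3 (f3 ▸ hpos.1)) _ fun c hc hc0 =>
      lt_hammingNorm_fourthCode (by omega) hβ (by decide) 1 _ (fun t ht => by omega) rfl c hc hc0
  have m1' : 3 ^ h + 3 ≤ 2 * minDist (fourthCode (2 * h + 1) β 1) := by omega
  have m3' : 3 ^ h + 1 ≤ 2 * minDist (fourthCode (2 * h + 1) β 3) := by omega
  have m1q : (3 : ℚ) ^ h + 3 ≤ 2 * minDist (fourthCode (2 * h + 1) β 1) := by exact_mod_cast m1'
  have m3q : (3 : ℚ) ^ h + 1 ≤ 2 * minDist (fourthCode (2 * h + 1) β 3) := by exact_mod_cast m3'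
  refine ⟨?_, ?_, rfl, ?_, ?_⟩
  · rw [pow_succ (-1 : ℚ)]
    linarith
  -- Uses `3 ^ h ≥ 9`; the comparison is an equality for `h = 2`.
  · rcases hsignq with hs | hs <;> rw [hs] <;> linarith
  · linarith
  · rcases hsignq with hs | hs <;> rw [hs] <;> linarith
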